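/- Write $e(x)=\mathrm e^{2\pi \mathrm i x}$, $\Lambda_R=\{n\in\mathbb Z^d:\ |n|_\infty\le R\}$, and for $u:\mathbb Z^d\to\mathbb C$ put $(\Delta u)(n)=\sum_{m\in\mathbb Z^d,\,|m|_1=1}u(n+m)$. A function $f$ on $\mathbb Z^d$ is $p$-periodic, $p\in(\mathbb Z_{>0})^d$, if it is invariant under translation by $p_i$ in the $i$-th coordinate for $i=1,\dots,d$. A sequence of periods $p^1,p^2,\dots\in(\mathbb Z_{>0})^d$ is increasing if $p^j_i$ divides $p^{j+1}_i$ for all $j\ge1$ and $1\le i\le d$. A function on $\mathbb Z^d$ is limit-periodic if it is the limit, in $\ell^\infty(\mathbb Z^d)$, of sums $f^1+\dots+f^j$ with $f^j$ being $p^j$-periodic for some increasing sequence of periods $p^j$. Let $d\ge 1$, let $\varepsilon_1>0$, and let $p^1,p^2,\dots$ be an increasing sequence of periods. Then there is a sequence $\varepsilon_j>0$, $j\ge2$, such that for all $p^j$-periodic potentials $V^j:\mathbb Z^d\to\mathbb R$ with $\|V^j\|_{\ell^\infty(\mathbb Z^d)}\le\varepsilon_j$, $j\ge1$, the limit $V=\lim_{j\to\infty}(V^1+\dots+V^j)$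 exists in $\ell^\infty(\mathbb Z^d)$ and the following holds for $H=\Delta+V$. For (Lebesgue) almost every $\theta\in\mathbb R^d$ there are $E\in\mathbb R$ and a non-zero $u:\mathbb Z^d\to\mathbb C$ that is limit-periodic with quasi-momentum $\theta$, i.e. $n\mapsto e(n\cdot\theta)\,u(n)$ is limit-periodic, such that $Hu=Eu$ and the limit $$\hat u(\theta)=\lim_{R\to\infty}\frac1{\#\Lambda_R}\sum_{n\in\Lambda_R}u(n)\,e(n_1\theta_1+\dots+n_d\theta_d)$$ exists and is non-zero. -/

import Mathlib

open Filter Topology MeasureTheory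

noncomputable section

namespace LimitPeriodicSchrodinger

/-- `V : ℤ^d → α` is `p`-periodic: invariant under the translation by `p i` in the `i`-th coordinate,
for every `i`. -/
def IsPeriodic {d : ℕ} {α : Type*} (p : Fin d → ℕ) (V : (Fin d → ℤ) → α) : Prop :=
  ∀ (i : Fin d) (n : Fin d → ℤ), V (n + Pi.single i (p i : ℤ)) = V n

/-- An increasing sequence of periods in `(ℤ_{>0})^d`: each component divides the same component of
the next period. The sequence is indexed from `0`. -/
def IsIncreasingPeriods {d : ℕ} (p : ℕ → Fin d → ℕ) : Prop :=
  (∀ j i, 0 < p j i) ∧ ∀ j i, p j i ∣ p (j + 1) i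

/-- The partial sums `W 0 + ... + W j` converge to `V` in the supremum norm. When every `W j` is
periodic (hence bounded) this is convergence in `ℓ^∞(ℤ^d)`, and `V` is bounded. -/
def SumsTo {d : ℕ} {α : Type*} [NormedAddCommGroup α]
    (W : ℕ → (Fin d → ℤ) → α) (V : (Fin d → ℤ) → α) : Prop :=
  TendstoUniformly (fun (j : ℕ) (n : Fin d → ℤ) => ∑ k ∈ Finset.range (j + 1), W k n) V atTop

/-- Limit-periodic functions on `ℤ^d`. -/
def IsLimitPeriodic {d : ℕ} {α : Type*} [NormedAddCommGroup α] (V : (Fin d → ℤ) → α) : Prop :=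
  ∃ (p : ℕ → Fin d → ℕ) (W : ℕ → (Fin d → ℤ) → α),
    IsIncreasingPeriods p ∧ (∀ j, IsPeriodic (p j) (W j)) ∧ SumsTo W V

/-- The discrete Laplacian: the sum over the `2 d` nearest neighbours, without a diagonal term. -/
def laplacian {d : ℕ} (u : (Fin d → ℤ) → ℂ) (n : Fin d → ℤ) : ℂ :=
  ∑ i : Fin d, (u (n + Pi.single i 1) + u (n - Pi.single i 1))

/-- The Schrödinger operator `H = Δ + V`, acting on arbitrary functions on `ℤ^d`. -/
def schrodinger {d : ℕ} (V : (Fin d → ℤ) → ℝ) (u : (Fin d → ℤ) → ℂ) (n : Fin d → ℤ) : ℂ :=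
  laplacian u n + (V n : ℂ) * u n

/-- The plane wave `e(n_1 θ_1 + ... + n_d θ_d)`, where `e(x) = exp(2 π i x)`. -/
def planeWave {d : ℕ} (θ : Fin d → ℝ) (n : Fin d → ℤ) : ℂ :=
  Complex.exp (2 * Real.pi * Complex.I * ((∑ i : Fin d, (n i : ℝ) * θ i : ℝ) : ℂ))

/-- The box `Λ_R(0) = {n ∈ ℤ^d : |n|_∞ ≤ R}`. -/
def box (d R : ℕ) : Finset (Fin d → ℤ) :=
  Fintype.piFinset fun _ => Finset.Icc (-(R : ℤ)) (R : ℤ)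

/-- The average of `u(n) e(n · θ)` over the box `Λ_R(0)`. -/
def boxAverage {d : ℕ} (u : (Fin d → ℤ) → ℂ) (θ : Fin d → ℝ) (R : ℕ) : ℂ :=
  ((box d R).card : ℂ)⁻¹ * ∑ n ∈ box d R, u n * planeWave θ n

/-- `u` is limit-periodic with quasi-momentum `θ` (a limit-periodic Bloch wave):
`u(n) = e(-n · θ) v(n)` with `v` limit-periodic. -/
def IsBlochLimitPeriodic {d : ℕ} (θ : Fin d → ℝ) (u : (Fin d → ℤ) → ℂ) : Prop :=
  IsLimitPeriodic fun n => planeWave θ n * u n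

end LimitPeriodicSchrodinger

end

/-!
The argument is an iterative perturbation scheme: the periods are given in advance, so each new
potential can be made small enough that non-degenerate perturbation theory applies outside a set of
quasi-momenta of small measure.

Fix a level `j`, and let `U j` be the partial sum `W 0 + ... + W j`, regarded as a potential with
period `q = p (j + 1)`. On Bloch waves `e(-n · θ) v(n)` with `v` of period `q`, the Schrödinger
operator is a Hermitian matrix (`floquetMatrix`) indexed by the finite group `G = ∏ i, ℤ / q i`.

* *Simple spectrum.* Its discriminant (`powerSumDiscr`) is non-zero for almost every `θ`. On the
  line `θ + t (1, ..., 1)` the matrix multiplied by `e(t)` is a polynomial in `e(t)`. Its constant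
  term only hops forward, so it is diagonalised by the characters of `G`, and for almost every `θ`
  it separates them. Hence the polynomial discriminant is non-zero and has finitely many roots
  (`ae_powerSumDiscr_floquetMatrix_ne_zero`).
* *Uniformity.* The potentials of period `q` bounded by a given constant form a compact set, so the
  discriminant is bounded below, by a constant independent of the potential, outside a set of `θ` in
  a given ball that has measure at most `2⁻ʲ` (`exists_forall_measure_lt_le`). There the eigenvalues
  are uniformly separated, and a perturbation smaller than some `ε (j + 1)` moves every eigenvector
  only slightly (`exists_near_eigenvector`, `exists_forall_measure_not_isStable_le`).
* *Limit.* By the Borel–Cantelli lemma almost every `θ` is good at all levels from some `J` on. The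
  constant function is a combination of orthonormal eigenvectors at level `J`, so one of the
  eigenvectors has a mean of size at least `1 / ∏ i, p J i` (`exists_bloch_wave_le_norm_mean`). The
  eigenvectors of the later levels that continue it converge uniformly, with a total displacement
  smaller than that mean, hence to a limit-periodic Bloch wave whose mean is not zero
  (`exists_limitPeriodic_eigenfunction`).
-/

noncomputable section

namespace LimitPeriodicSchrodinger

/-! ### A discriminant for matrices -/

section Discriminant

variable {ι κ R S : Type*} [Fintype ι] [DecidableEq ι] [Fintype κ] [DecidableEq κ]
  [CommRing R] [CommRing S]

/-- The discriminant of the characteristic polynomial of `A`, written as the Hankel determinant of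
the power sums `tr (A ^ (i + j))` of the eigenvalues. In this form it is visibly a polynomial in the
entries of `A`. -/
def powerSumDiscr (A : Matrix ι ι R) : R :=
  (Matrix.of fun i j : Fin (Fintype.card ι) => (A ^ (i + j : ℕ)).trace).det

lemma powerSumDiscr_map (f : R →+* S) (A : Matrix ι ι R) :
    powerSumDiscr (A.map f) = f (powerSumDiscr A) := by
  unfold powerSumDiscr
  rw [RingHom.map_det]
  congr 1
  ext i j
  simp only [Matrix.of_apply, RingHom.mapMatrix_apply, Matrix.map_apply]
  rw [← RingHom.mapMatrix_apply, ← map_pow, RingHom.mapMatrix_apply]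
  exact (AddMonoidHom.map_trace f.toAddMonoidHom _).symm

lemma powerSumDiscr_smul (c : R) (A : Matrix ι ι R) :
    powerSumDiscr (c • A) = (∏ i : Fin (Fintype.card ι), c ^ (i : ℕ)) ^ 2 * powerSumDiscr A := by
  unfold powerSumDiscr
  rw [sq, mul_assoc, ← Matrix.det_mul_row, ← Matrix.det_mul_column]
  congr 1
  ext i j
  simp only [Matrix.of_apply]
  rw [smul_pow, Matrix.trace_smul, smul_eq_mul, pow_add c]
  ring

lemma continuous_powerSumDiscr : Continuous (powerSumDiscr : Matrix ι ι ℂ → ℂ) := by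
  unfold powerSumDiscr
  refine Continuous.matrix_det (continuous_matrix fun i j => ?_)
  exact (continuous_pow _).matrix_trace

lemma trace_pow_of_eigenbasis (b : Module.Basis κ ℂ (ι → ℂ)) (A : Matrix ι ι ℂ) (l : κ → ℂ)
    (h : ∀ k, A.mulVec (b k) = l k • b k) (n : ℕ) : (A ^ n).trace = ∑ k, l k ^ n := by
  have hp : ∀ k, (A ^ n).mulVec (b k) = l k ^ n • b k := by
    intro k
    induction n with
    | zero => simp
    | succ n ih => rw [pow_succ', ← Matrix.mulVec_mulVec, ih, Matrix.mulVec_smul, h, smul_smul,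
        pow_succ]
  rw [← Matrix.trace_toLin'_eq, LinearMap.trace_eq_matrix_trace ℂ b, Matrix.trace]
  refine Finset.sum_congr rfl fun k _ => ?_
  rw [Matrix.diag_apply, LinearMap.toMatrix_apply, Matrix.toLin'_apply, hp]
  simp

lemma powerSumDiscr_eq_sq_det_vandermonde (b : Module.Basis κ ℂ (ι → ℂ)) (A : Matrix ι ι ℂ)
    (l : κ → ℂ) (h : ∀ k, A.mulVec (b k) = l k • b k) (e : Fin (Fintype.card ι) ≃ κ) :
    powerSumDiscr A = (Matrix.vandermonde (l ∘ e)).det ^ 2 := by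
  have : powerSumDiscr A =
      ((Matrix.vandermonde (l ∘ e)).transpose * Matrix.vandermonde (l ∘ e)).det := by
    unfold powerSumDiscr
    congr 1
    ext i j
    rw [Matrix.vandermonde_transpose_mul_vandermonde, Matrix.of_apply,
      trace_pow_of_eigenbasis b A l h]
    exact (Equiv.sum_comp e fun k => l k ^ (i + j : ℕ)).symm
  rw [this, Matrix.det_mul, Matrix.det_transpose, sq]

/-- Eigenvalues in a bounded region whose discriminant is bounded away from zero are uniformly
separated. -/
lemma exists_separation (N : ℕ) (B : ℝ) {δ : ℝ} (hδ : 0 < δ) :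
    ∃ g : ℝ, 0 < g ∧ ∀ l : Fin N → ℂ, (∀ i, ‖l i‖ ≤ B) →
      δ ≤ ‖(Matrix.vandermonde l).det ^ 2‖ → ∀ i j, i ≠ j → g ≤ ‖l i - l j‖ := by
  have hcont : Continuous fun l : Fin N → ℂ => ‖(Matrix.vandermonde l).det ^ 2‖ := by
    refine ((Continuous.matrix_det (continuous_matrix fun i j => ?_)).pow 2).norm
    simp only [Matrix.vandermonde_apply]
    fun_prop
  have hK : IsCompact {l : Fin N → ℂ | (∀ i, ‖l i‖ ≤ B) ∧
      δ ≤ ‖(Matrix.vandermonde l).det ^ 2‖} := by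
    refine IsCompact.of_isClosed_subset
      (isCompact_univ_pi fun _ : Fin N => isCompact_closedBall (0 : ℂ) B) ?_ ?_
    · have hset : {l : Fin N → ℂ | ∀ i, ‖l i‖ ≤ B} = ⋂ i, {l | ‖l i‖ ≤ B} := by
        ext l
        simp
      refine IsClosed.inter (s₁ := {l : Fin N → ℂ | ∀ i, ‖l i‖ ≤ B}) ?_
        (isClosed_le continuous_const hcont)
      rw [hset]
      exact isClosed_iInter fun i => isClosed_le (by fun_prop) continuous_const
    · intro l hl i _
      simpa using hl.1 i
  have key : ∀ᶠ g : ℝ in 𝓝[>] 0, ∀ q : Fin N × Fin N, q.1 ≠ q.2 →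
      ∀ l ∈ {l : Fin N → ℂ | (∀ i, ‖l i‖ ≤ B) ∧ δ ≤ ‖(Matrix.vandermonde l).det ^ 2‖},
        g ≤ ‖l q.1 - l q.2‖ := by
    refine eventually_all.2 fun q => ?_
    by_cases hq : q.1 = q.2
    · simp [hq]
    obtain ⟨a, ha, hle⟩ := hK.exists_forall_le' (f := fun l => ‖l q.1 - l q.2‖) (a := 0)
      (by fun_prop) (by
        rintro l ⟨-, hl⟩
        refine norm_pos_iff.2 (sub_ne_zero.2 fun h => ?_)
        have : (Matrix.vandermonde l).det = 0 :=
          Matrix.det_vandermonde_eq_zero_iff.2 ⟨_, _, h, hq⟩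
        simp [this] at hl
        linarith)
    filter_upwards [Ioo_mem_nhdsGT ha] with g hg _ l hl
    exact hg.2.le.trans (hle l hl)
  obtain ⟨g, hg, hpos⟩ := (key.and self_mem_nhdsWithin).exists
  exact ⟨g, hpos, fun l h1 h2 i j hij => hg (i, j) hij l ⟨h1, h2⟩⟩

end Discriminant

/-! ### Perturbation of simple eigenvectors -/

section Perturbation

variable {E ι κ : Type*} [NormedAddCommGroup E] [InnerProductSpace ℂ E] [Fintype ι] [Fintype κ]

lemma inner_apply_of_eigenbasis (e : OrthonormalBasis ι ℂ E) (A : E →ₗ[ℂ] E) (l : ι → ℝ)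
    (hA : ∀ i, A (e i) = (l i : ℂ) • e i) (i : ι) (x : E) :
    inner ℂ (e i) (A x) = l i * inner ℂ (e i) x := by
  classical
  conv_lhs => rw [← e.sum_repr' x]
  simp [map_sum, hA, orthonormal_iff_ite.1 e.orthonormal, mul_comm]

lemma norm_sq_apply_sub_smul (e : OrthonormalBasis ι ℂ E) (A : E →ₗ[ℂ] E) (l : ι → ℝ)
    (hA : ∀ i, A (e i) = (l i : ℂ) • e i) (μ : ℝ) (x : E) :
    ‖A x - (μ : ℂ) • x‖ ^ 2 = ∑ i, (l i - μ) ^ 2 * ‖inner ℂ (e i) x‖ ^ 2 := by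
  rw [← e.sum_sq_norm_inner_right]
  refine Finset.sum_congr rfl fun i _ => ?_
  rw [inner_sub_right, inner_apply_of_eigenbasis e A l hA, inner_smul_right, ← sub_mul, norm_mul,
    mul_pow, ← Complex.ofReal_sub, Complex.norm_real, Real.norm_eq_abs, sq_abs]

lemma norm_sub_inner_smul_sq {u w : E} (hu : ‖u‖ = 1) (hw : ‖w‖ = 1) :
    ‖u - inner ℂ w u • w‖ ^ 2 = 1 - ‖inner ℂ u w‖ ^ 2 := by
  have h := @norm_sub_sq ℂ E _ _ _ u (inner ℂ w u • w)
  rw [h, inner_smul_right, norm_smul, hu, hw]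
  rw [inner_mul_symm_re_eq_norm, norm_mul, norm_inner_symm w u]
  ring

/-- Let `A` and `A'` be diagonal in the orthonormal bases `e` and `f`, with `‖A' - A‖ ≤ ε`. If the
eigenvalue `l i` of `A` is isolated by `g`, then `e i` is close to a multiple of some `f k`. -/
theorem exists_near_eigenvector_of_basis (e : OrthonormalBasis ι ℂ E) (A : E →ₗ[ℂ] E) (l : ι → ℝ)
    (hA : ∀ i, A (e i) = (l i : ℂ) • e i) (f : OrthonormalBasis κ ℂ E) (A' : E →ₗ[ℂ] E)
    (m : κ → ℝ) (hA' : ∀ i, A' (f i) = (m i : ℂ) • f i) {ε g : ℝ} (hε : 0 ≤ ε) (hg : 0 < g)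
    (hεg : 2 * ε ≤ g) (hAA' : ∀ x, ‖A' x - A x‖ ≤ ε * ‖x‖) (i : ι)
    (hgap : ∀ j, j ≠ i → g ≤ |l j - l i|) :
    ∃ (k : κ) (c : ℂ), ‖c • f k - e i‖ ≤ 2 * ε / g := by
  classical
  have hu : ‖e i‖ = 1 := e.norm_eq_one i
  -- The residual of `e i` as an approximate eigenvector of `A'` bounds the distance from `l i` to
  -- the spectrum of `A'`.
  obtain ⟨k, hk⟩ : ∃ k, |m k - l i| ≤ ε := by
    by_contra! hcon
    have h1 := norm_sq_apply_sub_smul f A' m hA' (l i) (e i)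
    have h2 : ‖A' (e i) - (l i : ℂ) • e i‖ ≤ ε := by
      have := hAA' (e i)
      rwa [hA, hu, mul_one] at this
    have h3 : ∑ k, ‖inner ℂ (f k) (e i)‖ ^ 2 = 1 := by
      rw [f.sum_sq_norm_inner_right, hu, one_pow]
    have h4 : ∑ k, ε ^ 2 * ‖inner ℂ (f k) (e i)‖ ^ 2 <
        ∑ k, (m k - l i) ^ 2 * ‖inner ℂ (f k) (e i)‖ ^ 2 := by
      have hsq : ∀ k, ε ^ 2 < (m k - l i) ^ 2 := fun k => by
        rw [← sq_abs (m k - l i)]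
        exact pow_lt_pow_left₀ (hcon k) hε two_ne_zero
      refine Finset.sum_lt_sum (fun k _ => ?_) ?_
      · exact mul_le_mul_of_nonneg_right (hsq k).le (by positivity)
      · obtain ⟨k, hk, hk0⟩ := Finset.exists_ne_zero_of_sum_ne_zero (h3.trans_ne one_ne_zero)
        exact ⟨k, hk, mul_lt_mul_of_pos_right (hsq k) (lt_of_le_of_ne (by positivity) hk0.symm)⟩
    rw [← Finset.mul_sum, h3, ← h1, mul_one] at h4
    exact absurd h4 (not_lt.2 (pow_le_pow_left₀ (norm_nonneg _) h2 2))
  refine ⟨k, inner ℂ (f k) (e i), ?_⟩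
  have hw : ‖f k‖ = 1 := f.norm_eq_one k
  -- Conversely `f k` is an approximate eigenvector of `A`, hence almost orthogonal to every `e j`
  -- with `j ≠ i`.
  have h1 := norm_sq_apply_sub_smul e A l hA (m k) (f k)
  have h2 : ‖A (f k) - (m k : ℂ) • f k‖ ≤ ε := by
    have := hAA' (f k)
    rwa [hA', hw, mul_one, norm_sub_rev] at this
  have h3 : ∑ j, ‖inner ℂ (e j) (f k)‖ ^ 2 = 1 := by
    rw [e.sum_sq_norm_inner_right, hw, one_pow]
  have h4 : (g / 2) ^ 2 * (1 - ‖inner ℂ (e i) (f k)‖ ^ 2) ≤ ε ^ 2 := by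
    calc (g / 2) ^ 2 * (1 - ‖inner ℂ (e i) (f k)‖ ^ 2)
        = ∑ j ∈ Finset.univ.erase i, (g / 2) ^ 2 * ‖inner ℂ (e j) (f k)‖ ^ 2 := by
          rw [← h3, ← Finset.add_sum_erase _ _ (Finset.mem_univ i), ← Finset.mul_sum]
          ring
      _ ≤ ∑ j ∈ Finset.univ.erase i, (l j - m k) ^ 2 * ‖inner ℂ (e j) (f k)‖ ^ 2 := by
          refine Finset.sum_le_sum fun j hj => ?_
          refine mul_le_mul_of_nonneg_right ?_ (by positivity)
          rw [← sq_abs (l j - m k)]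
          refine pow_le_pow_left₀ (by positivity) ?_ 2
          have h5 := hgap j (Finset.ne_of_mem_erase hj)
          have h6 := abs_sub_le (l j) (m k) (l i)
          linarith
      _ ≤ ∑ j, (l j - m k) ^ 2 * ‖inner ℂ (e j) (f k)‖ ^ 2 :=
          Finset.sum_le_univ_sum_of_nonneg fun j => by positivity
      _ ≤ ε ^ 2 := by
          rw [← h1]
          exact pow_le_pow_left₀ (norm_nonneg _) h2 2
  rw [norm_sub_rev, ← abs_of_nonneg (show 0 ≤ 2 * ε / g by positivity), ← abs_norm, ← sq_le_sq,
    norm_sub_inner_smul_sq hu hw, div_pow, le_div_iff₀ (by positivity)]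
  nlinarith

/-- An eigenvector of `A`, whose eigenvalues are separated by `g`, is close to an eigenvector (or
zero) of a nearby `A'`. -/
theorem exists_near_eigenvector (e : OrthonormalBasis ι ℂ E) (A : E →ₗ[ℂ] E) (l : ι → ℝ)
    (hA : ∀ i, A (e i) = (l i : ℂ) • e i) (f : OrthonormalBasis κ ℂ E) (A' : E →ₗ[ℂ] E)
    (m : κ → ℝ) (hA' : ∀ i, A' (f i) = (m i : ℂ) • f i) {ε g : ℝ} (hε : 0 ≤ ε) (hg : 0 < g)
    (hεg : 2 * ε ≤ g) (hAA' : ∀ x, ‖A' x - A x‖ ≤ ε * ‖x‖)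
    (hgap : ∀ i j, i ≠ j → g ≤ |l i - l j|) {u : E} {lam : ℝ} (hu : A u = (lam : ℂ) • u) :
    ∃ (μ : ℝ) (v : E), A' v = (μ : ℂ) • v ∧ ‖v - u‖ ≤ 2 * ε / g * ‖u‖ := by
  classical
  by_cases hu0 : ∀ i, inner ℂ (e i) u = 0
  · refine ⟨0, 0, by simp, ?_⟩
    have : u = 0 := by
      rw [← e.sum_repr' u]
      simp [hu0]
    simp [this]
  push Not at hu0
  obtain ⟨i, hi⟩ := hu0
  have hl : ∀ j, inner ℂ (e j) u ≠ 0 → l j = lam := by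
    intro j hj
    have h := inner_apply_of_eigenbasis e A l hA j u
    rw [hu, inner_smul_right] at h
    exact_mod_cast (mul_right_cancel₀ hj h).symm
  have hui : u = inner ℂ (e i) u • e i := by
    conv_lhs => rw [← e.sum_repr' u]
    refine Finset.sum_eq_single i (fun j _ hj => ?_) (by simp)
    by_contra hne
    have h := hgap j i hj
    rw [hl j fun h0 => hne (by simp [h0]), hl i hi, sub_self, abs_zero] at h
    linarith
  obtain ⟨k, c, hc⟩ := exists_near_eigenvector_of_basis e A l hA f A' m hA' hε hg hεg hAA' i
    fun j hj => hgap j i hj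
  refine ⟨m k, (inner ℂ (e i) u * c) • f k, ?_, ?_⟩
  · rw [map_smul, hA', smul_comm]
  · have hnorm : ‖u‖ = ‖(inner ℂ (e i) u : ℂ)‖ := by
      conv_lhs => rw [hui, norm_smul, e.norm_eq_one, mul_one]
    calc ‖(inner ℂ (e i) u * c) • f k - u‖
        = ‖(inner ℂ (e i) u : ℂ) • (c • f k - e i)‖ := by
          conv_lhs => rw [hui]
          rw [smul_sub, smul_smul, ← hui]
      _ ≤ 2 * ε / g * ‖u‖ := by
          rw [norm_smul, ← hnorm, mul_comm]
          exact mul_le_mul_of_nonneg_right hc (norm_nonneg _)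

end Perturbation

/-! ### Floquet matrices -/

section Floquet

lemma exists_addChar_ne {d : ℕ} {G : Type*} [AddCommGroup G] {s : Fin d → G}
    (hs : ∀ x : G, ∃ n : Fin d → ℤ, x = ∑ i, n i • s i)
    {χ ψ : AddChar G ℂ} (h : χ ≠ ψ) : ∃ i, χ (s i) ≠ ψ (s i) := by
  contrapose! h
  ext x
  obtain ⟨n, rfl⟩ := hs x
  refine Finset.sum_induction _ (fun x => χ x = ψ x) (fun x y hx hy => ?_) ?_ fun i _ => ?_
  · rw [AddChar.map_add_eq_mul, AddChar.map_add_eq_mul, hx, hy]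
  · rw [AddChar.map_zero_eq_one, AddChar.map_zero_eq_one]
  · rw [AddChar.map_zsmul_eq_zpow, AddChar.map_zsmul_eq_zpow, h]

variable {d : ℕ} {G R S : Type*} [AddCommGroup G] [DecidableEq G] [CommRing R] [CommRing S]

/-- The character `e(x) = exp(2 π i x)`. -/
def wave (x : ℝ) : ℂ := Complex.exp (2 * Real.pi * Complex.I * (x : ℂ))

lemma wave_add (x y : ℝ) : wave (x + y) = wave x * wave y := by
  simp only [wave, ← Complex.exp_add]
  push_cast
  ring_nf

lemma wave_zero : wave 0 = 1 := by simp [wave]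

lemma wave_ne_zero (x : ℝ) : wave x ≠ 0 := Complex.exp_ne_zero _

lemma wave_mul_wave_neg (x : ℝ) : wave x * wave (-x) = 1 := by
  rw [← wave_add, add_neg_cancel, wave_zero]

lemma norm_wave (x : ℝ) : ‖wave x‖ = 1 := by
  rw [wave, show (2 * Real.pi * Complex.I * x : ℂ) = ((2 * Real.pi * x : ℝ) : ℂ) * Complex.I by
    push_cast; ring]
  exact Complex.norm_exp_ofReal_mul_I _

lemma star_wave (x : ℝ) : star (wave x) = wave (-x) := by
  simp only [wave, Complex.star_def, ← Complex.exp_conj]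
  simp [map_ofNat]

lemma continuous_wave : Continuous wave := by
  unfold wave
  fun_prop

lemma countable_wave_eq (c : ℂ) : {t : ℝ | wave t = c}.Countable := by
  by_cases h : ∃ t, wave t = c
  · obtain ⟨t, rfl⟩ := h
    refine (Set.countable_range fun n : ℤ => t + n).mono fun r hr => ?_
    obtain ⟨n, hn⟩ := Complex.exp_eq_exp_iff_exists_int.1 hr
    refine ⟨n, ?_⟩
    have h2 : (2 * Real.pi * Complex.I : ℂ) ≠ 0 := by simp [Real.pi_ne_zero]
    have h3 : (r : ℂ) = t + n := mul_left_cancel₀ h2 (by rw [hn]; ring)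
    exact_mod_cast h3.symm
  · push Not at h
    simp [h]

lemma ae_eval_wave_ne_zero {P : Polynomial ℂ} (hP : P ≠ 0) :
    ∀ᵐ t : ℝ, P.eval (wave t) ≠ 0 := by
  have h : {t : ℝ | P.eval (wave t) = 0}.Countable := by
    refine (Set.Countable.biUnion (t := fun c _ => {t : ℝ | wave t = c})
      P.roots.toFinset.countable_toSet fun c _ => countable_wave_eq c).mono fun t ht => ?_
    simp only [Set.mem_iUnion]
    exact ⟨wave t, by simpa [hP] using ht, rfl⟩
  filter_upwards [h.ae_notMem volume] with t ht using ht

/-- For almost every `θ` the operator with amplitudes `e(-θ i)` along `s i` and nothing else, which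
dominates the Floquet matrix at complex quasi-momentum, separates the characters of `G`. -/
lemma ae_injective_symbol {d : ℕ} {G : Type*} [AddCommGroup G] [Fintype G]
    {s : Fin d → G} (hs : ∀ x : G, ∃ n : Fin d → ℤ, x = ∑ i, n i • s i) :
    ∀ᵐ θ : Fin d → ℝ, Function.Injective fun χ : AddChar G ℂ => ∑ i, wave (-θ i) * χ (s i) := by
  have hw := continuous_wave
  have key : ∀ χ ψ : AddChar G ℂ, χ ≠ ψ →
      ∀ᵐ θ : Fin d → ℝ, ∑ i, wave (-θ i) * (χ (s i) - ψ (s i)) ≠ 0 := by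
    intro χ ψ hne
    obtain ⟨i, hi⟩ := exists_addChar_ne hs hne
    refine ae_mem_of_ae_add_linearMap_mem
      (s := {θ : Fin d → ℝ | ∑ i, wave (-θ i) * (χ (s i) - ψ (s i)) ≠ 0})
      (LinearMap.toSpanSingleton ℝ (Fin d → ℝ) (Pi.single i (-1))) volume volume
      (isOpen_ne_fun (by fun_prop) continuous_const).measurableSet fun θ => ?_
    -- Along the `i`-th axis the sum is an affine function of `e(t)`.
    let P : Polynomial ℂ := Polynomial.C (wave (-θ i) * (χ (s i) - ψ (s i))) * Polynomial.X +
      Polynomial.C (∑ j ∈ Finset.univ.erase i, wave (-θ j) * (χ (s j) - ψ (s j)))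
    have hP : P ≠ 0 := by
      intro h0
      have h1 := congr_arg (fun Q => Polynomial.coeff Q 1) h0
      simp [P, Polynomial.coeff_C, wave_ne_zero, sub_eq_zero, hi] at h1
    filter_upwards [ae_eval_wave_ne_zero hP] with t ht
    refine fun h0 => ht ?_
    rw [← h0, ← Finset.add_sum_erase _ _ (Finset.mem_univ i)]
    simp only [P, Polynomial.eval_add, Polynomial.eval_mul, Polynomial.eval_C, Polynomial.eval_X]
    congr 1
    · simp [wave_add]
      ring
    · refine Finset.sum_congr rfl fun j hj => ?_
      simp [Finset.ne_of_mem_erase hj]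
  have := ae_all_iff.2 fun χ => ae_all_iff.2 fun ψ => eventually_imp_distrib_left.2 (key χ ψ)
  filter_upwards [this] with θ hθ χ ψ h
  by_contra hne
  refine hθ χ ψ hne ?_
  simp only [mul_sub, Finset.sum_sub_distrib]
  exact sub_eq_zero.2 h

/-- The matrix, indexed by a finite quotient `G` of `ℤ^d`, of a nearest-neighbour operator with
hopping amplitudes `a i` and `b i` along `s i` and `- s i` (the image of the `i`-th unit vector in
`G`), and with potential `V`. -/
def hoppingMatrix (s : Fin d → G) (a b : Fin d → R) (V : G → R) : Matrix G G R :=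
  Matrix.of fun x y => ∑ i, ((if y = x + s i then a i else 0) + if y = x - s i then b i else 0) +
    if y = x then V x else 0

lemma hoppingMatrix_map (f : R →+* S) (s : Fin d → G) (a b : Fin d → R) (V : G → R) :
    (hoppingMatrix s a b V).map f =
      hoppingMatrix s (fun i => f (a i)) (fun i => f (b i)) fun x => f (V x) := by
  ext x y
  simp [hoppingMatrix, apply_ite f]

lemma smul_hoppingMatrix (c : R) (s : Fin d → G) (a b : Fin d → R) (V : G → R) :
    c • hoppingMatrix s a b V =
      hoppingMatrix s (fun i => c * a i) (fun i => c * b i) fun x => c * V x := by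
  ext x y
  simp [hoppingMatrix, mul_add, Finset.mul_sum]

lemma hoppingMatrix_mulVec [Fintype G] (s : Fin d → G) (a b : Fin d → R) (V v : G → R) (x : G) :
    (hoppingMatrix s a b V).mulVec v x =
      ∑ i, (a i * v (x + s i) + b i * v (x - s i)) + V x * v x := by
  simp only [hoppingMatrix, Matrix.mulVec, dotProduct, Matrix.of_apply, add_mul, Finset.sum_mul,
    ite_mul, zero_mul, Finset.sum_add_distrib]
  rw [Finset.sum_comm, Finset.sum_comm (s := Finset.univ (α := G))]
  simp

/-- The fibre at quasi-momentum `θ` of the Schrödinger operator whose potential is the lift of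
`V : G → ℝ`: its action on the periodic part `v` of the Bloch wave `e(-n · θ) v(n)`. -/
def floquetMatrix (s : Fin d → G) (θ : Fin d → ℝ) (V : G → ℝ) : Matrix G G ℂ :=
  hoppingMatrix s (fun i => wave (-θ i)) (fun i => wave (θ i)) fun x => (V x : ℂ)

lemma isHermitian_floquetMatrix (s : Fin d → G) (θ : Fin d → ℝ) (V : G → ℝ) :
    (floquetMatrix s θ V).IsHermitian := by
  ext x y
  simp only [floquetMatrix, hoppingMatrix, Matrix.conjTranspose_apply, Matrix.of_apply, star_add,
    star_sum, apply_ite (star : ℂ → ℂ), star_wave, star_zero, neg_neg]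
  congr 1
  · refine Finset.sum_congr rfl fun i _ => ?_
    rw [add_comm]
    exact congr_arg₂ (· + ·) (if_congr (eq_sub_iff_add_eq.trans eq_comm) rfl rfl)
      (if_congr (eq_comm.trans eq_sub_iff_add_eq.symm) rfl rfl)
  · by_cases h : x = y
    · simp [h]
    · simp [h, Ne.symm h]

lemma continuous_floquetMatrix (s : Fin d → G) :
    Continuous fun q : (G → ℝ) × (Fin d → ℝ) => floquetMatrix s q.2 q.1 := by
  have h := continuous_wave
  refine continuous_matrix fun x y => ?_
  simp only [floquetMatrix, hoppingMatrix, Matrix.of_apply]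
  refine Continuous.add (continuous_finsetSum _ fun i _ => Continuous.add ?_ ?_) ?_
  all_goals split_ifs <;> fun_prop

lemma continuous_floquetMatrix_right (s : Fin d → G) (V : G → ℝ) :
    Continuous fun θ : Fin d → ℝ => floquetMatrix s θ V :=
  (continuous_floquetMatrix s).comp (f := fun θ => (V, θ)) (Continuous.prodMk_right V)

variable [Fintype G]

lemma norm_eigenvalue_floquetMatrix_le (s : Fin d → G) (θ : Fin d → ℝ) {V : G → ℝ} {B : ℝ}
    (hV : ∀ x, |V x| ≤ B) {v : G → ℂ} (hv : v ≠ 0) {l : ℂ}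
    (h : (floquetMatrix s θ V).mulVec v = l • v) : ‖l‖ ≤ 2 * d + B := by
  obtain ⟨x, hx⟩ := Finite.exists_max fun x => ‖v x‖
  have hpos : 0 < ‖v x‖ := by
    obtain ⟨y, hy⟩ := Function.ne_iff.1 hv
    exact (norm_pos_iff.2 hy).trans_le (hx y)
  have h1 := congr_fun h x
  rw [floquetMatrix, hoppingMatrix_mulVec, Pi.smul_apply, smul_eq_mul] at h1
  refine le_of_mul_le_mul_right ?_ hpos
  rw [← norm_mul, ← h1, add_mul]
  refine norm_add_le_of_le ((norm_sum_le_of_le _ (f := _)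
    (n := fun _ => 2 * ‖v x‖) fun i _ => ?_).trans_eq ?_) ?_
  · rw [two_mul]
    refine norm_add_le_of_le ?_ ?_ <;> rw [norm_mul, norm_wave, one_mul] <;> exact hx _
  · simp
    ring
  · rw [norm_mul, Complex.norm_real, Real.norm_eq_abs]
    exact mul_le_mul_of_nonneg_right (hV x) hpos.le

lemma powerSumDiscr_hoppingMatrix_ne_zero (s : Fin d → G) (a : Fin d → ℂ)
    (h : Function.Injective fun χ : AddChar G ℂ => ∑ i, a i * χ (s i)) :
    powerSumDiscr (hoppingMatrix s a 0 0) ≠ 0 := by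
  classical
  have e : Fin (Fintype.card G) ≃ AddChar G ℂ :=
    (Fintype.equivFinOfCardEq AddChar.card_eq).symm
  rw [powerSumDiscr_eq_sq_det_vandermonde (AddChar.complexBasis G) _
    (fun χ : AddChar G ℂ => ∑ i, a i * χ (s i)) _ e]
  · exact pow_ne_zero 2 (Matrix.det_vandermonde_ne_zero_iff.2 (h.comp e.injective))
  · intro χ
    ext x
    simp only [hoppingMatrix_mulVec, AddChar.complexBasis_apply, Pi.smul_apply, smul_eq_mul,
      Pi.zero_apply, zero_mul, add_zero, Finset.sum_mul, AddChar.map_add_eq_mul]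
    exact Finset.sum_congr rfl fun i _ => by ring

/-- For a fixed potential the Floquet matrix has simple spectrum at almost every quasi-momentum:
along the diagonal direction its discriminant is, up to a unit, a polynomial in `e(t)`, whose
constant term is the discriminant of the matrix that only hops forward. -/
theorem ae_powerSumDiscr_floquetMatrix_ne_zero {s : Fin d → G}
    (hs : ∀ x : G, ∃ n : Fin d → ℤ, x = ∑ i, n i • s i) (V : G → ℝ) :
    ∀ᵐ θ : Fin d → ℝ, powerSumDiscr (floquetMatrix s θ V) ≠ 0 := by
  have hcont : Continuous fun θ : Fin d → ℝ => powerSumDiscr (floquetMatrix s θ V) :=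
    continuous_powerSumDiscr.comp (f := fun θ => floquetMatrix s θ V)
      (continuous_floquetMatrix_right s V)
  refine (ae_ae_add_linearMap_mem_iff (s := {θ | powerSumDiscr (floquetMatrix s θ V) ≠ 0})
    (LinearMap.toSpanSingleton ℝ (Fin d → ℝ) fun _ => 1) volume volume
      (isOpen_ne_fun hcont continuous_const).measurableSet).1 ?_
  filter_upwards [ae_injective_symbol hs] with θ hθ
  let Q : Matrix G G (Polynomial ℂ) :=
    hoppingMatrix s (fun i => Polynomial.C (wave (-θ i)))
      (fun i => Polynomial.X ^ 2 * Polynomial.C (wave (θ i)))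
      fun x => Polynomial.X * Polynomial.C (V x : ℂ)
  have heval : ∀ c : ℂ, (powerSumDiscr Q).eval c = powerSumDiscr (hoppingMatrix s
      (fun i => wave (-θ i)) (fun i => c ^ 2 * wave (θ i)) fun x => c * (V x : ℂ)) := by
    intro c
    rw [← Polynomial.coe_evalRingHom, ← powerSumDiscr_map, hoppingMatrix_map]
    congr 2 <;> ext <;> simp only [Polynomial.coe_evalRingHom, Polynomial.eval_mul,
      Polynomial.eval_pow, Polynomial.eval_X, Polynomial.eval_C]
  have hQ : powerSumDiscr Q ≠ 0 := by
    intro h0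
    have h1 := heval 0
    rw [h0, Polynomial.eval_zero] at h1
    refine powerSumDiscr_hoppingMatrix_ne_zero s (fun i => wave (-θ i)) hθ ?_
    rw [h1]
    congr 2 <;> ext <;> simp
  filter_upwards [ae_eval_wave_ne_zero hQ] with t ht h0
  refine ht ?_
  -- Multiplication by `e(t)` turns the Floquet matrix at `θ + t (1, ..., 1)` into `Q` at `e(t)`.
  have hsc : hoppingMatrix s (fun i => wave (-θ i)) (fun i => wave t ^ 2 * wave (θ i))
      (fun x => wave t * (V x : ℂ)) = wave t • floquetMatrix s (θ + t • fun _ => 1) V := by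
    rw [floquetMatrix, smul_hoppingMatrix]
    congr 1
    · ext i
      rw [← wave_add]
      congr 1
      simp
    · ext i
      simp only [Pi.add_apply, Pi.smul_apply, smul_eq_mul, mul_one, wave_add]
      ring
  rw [heval, hsc, powerSumDiscr_smul]
  exact mul_eq_zero_of_right _ h0

end Floquet

/-! ### Uniformity in the potential -/

lemma exists_forall_measure_lt_le {α β : Type*} [TopologicalSpace α] [TopologicalSpace β]
    [MeasurableSpace β] [OpensMeasurableSpace β] (μ : Measure β) {K : Set α} (hK : IsCompact K)
    {T : Set β} (hT : IsCompact T) (hTm : MeasurableSet T) (hμT : μ T ≠ ⊤) {F : α → β → ℝ}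
    (hF : Continuous (Function.uncurry F)) (h0 : ∀ a ∈ K, ∀ᵐ b ∂μ, 0 < F a b) {η : ENNReal}
    (hη : η ≠ 0) : ∃ δ : ℝ, 0 < δ ∧ ∀ a ∈ K, μ {b ∈ T | F a b < δ} ≤ η := by
  refine hK.induction_on (p := fun S => ∃ δ : ℝ, 0 < δ ∧ ∀ a ∈ S, μ {b ∈ T | F a b < δ} ≤ η)
    ⟨1, one_pos, by simp⟩ ?_ ?_ ?_
  · rintro S S' hSS ⟨δ, hδ, h⟩
    exact ⟨δ, hδ, fun a ha => h a (hSS ha)⟩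
  · rintro S S' ⟨δ, hδ, h⟩ ⟨δ', hδ', h'⟩
    refine ⟨min δ δ', lt_min hδ hδ', ?_⟩
    rintro a (ha | ha)
    · refine le_trans (measure_mono ?_) (h a ha)
      exact fun b hb => ⟨hb.1, hb.2.trans_le (min_le_left _ _)⟩
    · refine le_trans (measure_mono ?_) (h' a ha)
      exact fun b hb => ⟨hb.1, hb.2.trans_le (min_le_right _ _)⟩
  · intro a ha
    have hFa : Continuous (F a) := hF.comp (by fun_prop : Continuous fun b => (a, b))
    have hlim := tendsto_measure_iInter_atTop (μ := μ)
      (s := fun n : ℕ => {b ∈ T | F a b < 1 / ((n : ℝ) + 1)})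
      (fun n => (hTm.inter (isOpen_lt hFa continuous_const).measurableSet).nullMeasurableSet)
      (fun m n hmn b hb => ⟨hb.1, hb.2.trans_le (Nat.one_div_le_one_div hmn)⟩)
      ⟨0, measure_ne_top_of_subset (fun b hb => hb.1) hμT⟩
    have hzero : μ (⋂ n : ℕ, {b ∈ T | F a b < 1 / ((n : ℝ) + 1)}) = 0 := by
      refine measure_mono_null (fun b hb => ?_) (ae_iff.1 (h0 a ha))
      intro hpos
      obtain ⟨n, hn⟩ := exists_nat_one_div_lt hpos
      exact lt_asymm hn (Set.mem_iInter.1 hb n).2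
    rw [hzero] at hlim
    obtain ⟨n, hn⟩ := (hlim.eventually (gt_mem_nhds (pos_iff_ne_zero.2 hη))).exists
    set δ : ℝ := 1 / ((n : ℝ) + 1) with hδ
    have hδ0 : 0 < δ := Nat.one_div_pos_of_nat
    have hnear : ∀ᶠ a' in 𝓝 a, ∀ b ∈ T, F a b - F a' b < δ / 2 := by
      refine hT.eventually_forall_of_forall_eventually fun b _ => ?_
      have hc : Continuous fun q : α × β => F a q.2 - F q.1 q.2 :=
        (hFa.comp continuous_snd).sub hF
      exact hc.continuousAt.eventually (gt_mem_nhds (by simpa using hδ0))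
    refine ⟨_, mem_nhdsWithin_of_mem_nhds hnear, δ / 2, by positivity, fun a' ha' => ?_⟩
    refine le_trans (measure_mono ?_) hn.le
    refine fun b hb => ⟨hb.1, ?_⟩
    have h1 := ha' b hb.1
    have h2 := hb.2
    change F a b < δ
    linarith

section Stability

lemma toEuclideanLin_eigenvectorBasis {G : Type*} [DecidableEq G] [Fintype G]
    {A : Matrix G G ℂ} (hA : A.IsHermitian) (i : G) :
    Matrix.toEuclideanLin A (hA.eigenvectorBasis i) =
      (hA.eigenvalues i : ℂ) • hA.eigenvectorBasis i := by
  ext x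
  have := congr_fun (hA.mulVec_eigenvectorBasis i) x
  simpa using this

variable {d : ℕ} {G : Type*} [AddCommGroup G] [DecidableEq G] [Fintype G]

/-- Every eigenvector `v` of the Floquet matrix at `θ` with `‖v‖_∞ ≤ 2` moves by at most `κ` (in the
supremum norm, to an eigenvector or to zero) when the potential `V` is perturbed by at most `ε`. -/
def IsStable (s : Fin d → G) (V : G → ℝ) (ε κ : ℝ) (θ : Fin d → ℝ) : Prop :=
  ∀ (W : G → ℝ) (v : G → ℂ) (l : ℝ), (∀ x, |W x| ≤ ε) → (∀ x, ‖v x‖ ≤ 2) →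
    (floquetMatrix s θ V).mulVec v = (l : ℂ) • v →
    ∃ (m : ℝ) (w : G → ℂ), (floquetMatrix s θ fun x => V x + W x).mulVec w = (m : ℂ) • w ∧
      ∀ x, ‖w x - v x‖ ≤ κ

lemma exists_separation_floquetMatrix (s : Fin d → G) (B : ℝ) {δ : ℝ} (hδ : 0 < δ) :
    ∃ g : ℝ, 0 < g ∧ ∀ (V : G → ℝ) (θ : Fin d → ℝ), (∀ x, |V x| ≤ B) →
      δ ≤ ‖powerSumDiscr (floquetMatrix s θ V)‖ → ∀ i j, i ≠ j →
      g ≤ |(isHermitian_floquetMatrix s θ V).eigenvalues i -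
        (isHermitian_floquetMatrix s θ V).eigenvalues j| := by
  obtain ⟨g, hg, h⟩ := exists_separation (Fintype.card G) (2 * d + B) hδ
  refine ⟨g, hg, fun V θ hV hD i j hij => ?_⟩
  set hA := isHermitian_floquetMatrix s θ V
  have e : Fin (Fintype.card G) ≃ G := (Fintype.equivFin G).symm
  have hev : ∀ k, (floquetMatrix s θ V).mulVec (hA.eigenvectorBasis k) =
      (hA.eigenvalues k : ℂ) • ⇑(hA.eigenvectorBasis k) := fun k => by
    rw [hA.mulVec_eigenvectorBasis k]
    ext x
    simp
  rw [powerSumDiscr_eq_sq_det_vandermonde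
    (hA.eigenvectorBasis.toBasis.map (WithLp.linearEquiv 2 ℂ (G → ℂ))) _
    (fun k => (hA.eigenvalues k : ℂ)) (fun k => by simpa using hev k) e] at hD
  have h1 := h _ (fun k => ?_) hD (e.symm i) (e.symm j) (fun h => hij (e.symm.injective h))
  · simpa [← Complex.ofReal_sub] using h1
  · refine norm_eigenvalue_floquetMatrix_le s θ hV (v := hA.eigenvectorBasis (e k)) ?_ (hev _)
    intro h0
    have h1 := hA.eigenvectorBasis.norm_eq_one (e k)
    rw [show hA.eigenvectorBasis (e k) = 0 by ext x; exact congr_fun h0 x, norm_zero] at h1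
    exact zero_ne_one h1

lemma isStable_of_separated {s : Fin d → G} {V : G → ℝ} {θ : Fin d → ℝ} {g κ : ℝ} (hg : 0 < g)
    (hgap : ∀ i j, i ≠ j → g ≤ |(isHermitian_floquetMatrix s θ V).eigenvalues i -
      (isHermitian_floquetMatrix s θ V).eigenvalues j|) {ε : ℝ} (hε : 0 ≤ ε) (hεg : 2 * ε ≤ g)
    (hκ : 4 * Fintype.card G * ε ≤ g * κ) : IsStable s V ε κ θ := by
  intro W v l hW hv hvl
  have hdiff : ∀ z, ‖Matrix.toEuclideanLin (floquetMatrix s θ fun x => V x + W x) z -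
      Matrix.toEuclideanLin (floquetMatrix s θ V) z‖ ≤ ε * ‖z‖ := by
    intro z
    rw [EuclideanSpace.norm_eq, EuclideanSpace.norm_eq, ← Real.sqrt_sq hε,
      ← Real.sqrt_mul (by positivity), Finset.mul_sum]
    refine Real.sqrt_le_sqrt (Finset.sum_le_sum fun x _ => ?_)
    have hx : (Matrix.toEuclideanLin (floquetMatrix s θ fun x => V x + W x) z -
        Matrix.toEuclideanLin (floquetMatrix s θ V) z) x = W x * z x := by
      simp only [PiLp.sub_apply, Matrix.toLpLin_apply, floquetMatrix, hoppingMatrix_mulVec]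
      push_cast
      ring
    rw [hx, norm_mul, mul_pow, Complex.norm_real, Real.norm_eq_abs]
    exact mul_le_mul_of_nonneg_right (pow_le_pow_left₀ (abs_nonneg _) (hW x) 2) (by positivity)
  have hvl' : Matrix.toEuclideanLin (floquetMatrix s θ V) (WithLp.toLp 2 v) =
      (l : ℂ) • WithLp.toLp 2 v := by
    ext x
    simpa using congr_fun hvl x
  obtain ⟨m, w, hw, hwv⟩ := exists_near_eigenvector
    (isHermitian_floquetMatrix s θ V).eigenvectorBasis _ _ (toEuclideanLin_eigenvectorBasis _)
    (isHermitian_floquetMatrix s θ fun x => V x + W x).eigenvectorBasis _ _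
    (toEuclideanLin_eigenvectorBasis _) hε hg hεg hdiff hgap hvl'
  refine ⟨m, w, ?_, fun x => ?_⟩
  · ext x
    simpa using congr_arg (fun z : EuclideanSpace ℂ G => z x) hw
  · have h1 : ‖w x - v x‖ ≤ ‖w - WithLp.toLp 2 v‖ := by
      simpa using PiLp.norm_apply_le (w - WithLp.toLp 2 v) x
    have h2 : ‖(WithLp.toLp 2 v : EuclideanSpace ℂ G)‖ ≤ 2 * Fintype.card G := by
      rw [EuclideanSpace.norm_eq]
      refine Real.sqrt_le_iff.2 ⟨by positivity, ?_⟩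
      have hc : (1 : ℝ) ≤ Fintype.card G := by exact_mod_cast Fintype.card_pos
      calc ∑ x, ‖v x‖ ^ 2 ≤ ∑ _x : G, (2 : ℝ) ^ 2 :=
            Finset.sum_le_sum fun x _ => pow_le_pow_left₀ (norm_nonneg _) (hv x) 2
        _ ≤ _ := by
          simp
          nlinarith
    calc ‖w x - v x‖ ≤ 2 * ε / g * (2 * Fintype.card G) :=
          h1.trans (hwv.trans (mul_le_mul_of_nonneg_left h2 (by positivity)))
      _ ≤ κ := by
          rw [div_mul_eq_mul_div, div_le_iff₀ hg]
          linarith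

/-- Stability outside a set of small measure, with a perturbation size that does not depend on the
potential. -/
theorem exists_forall_measure_not_isStable_le {s : Fin d → G}
    (hs : ∀ x : G, ∃ n : Fin d → ℤ, x = ∑ i, n i • s i) (B r : ℝ) {κ : ℝ} (hκ : 0 < κ)
    {η : ENNReal} (hη : η ≠ 0) :
    ∃ ε : ℝ, 0 < ε ∧ ∀ V : G → ℝ, (∀ x, |V x| ≤ B) →
      volume {θ ∈ Metric.closedBall (0 : Fin d → ℝ) r | ¬ IsStable s V ε κ θ} ≤ η := by
  obtain ⟨δ, hδ, h⟩ := exists_forall_measure_lt_le (volume : Measure (Fin d → ℝ))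
    (isCompact_univ_pi fun _ : G => isCompact_Icc (a := -B) (b := B))
    (isCompact_closedBall (0 : Fin d → ℝ) r) measurableSet_closedBall
    measure_closedBall_lt_top.ne (F := fun V θ => ‖powerSumDiscr (floquetMatrix s θ V)‖)
    (continuous_powerSumDiscr.comp (continuous_floquetMatrix s)).norm
    (fun V _ => by simpa using ae_powerSumDiscr_floquetMatrix_ne_zero hs V) hη
  obtain ⟨g, hg, hsep⟩ := exists_separation_floquetMatrix s B hδ
  have hc : (0 : ℝ) < Fintype.card G := by exact_mod_cast Fintype.card_pos
  refine ⟨min (g / 2) (g * κ / (4 * Fintype.card G)), by positivity, fun V hV => ?_⟩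
  refine le_trans (measure_mono ?_) (h V fun x _ => abs_le.1 (hV x))
  refine fun θ hθ => ⟨hθ.1, ?_⟩
  by_contra hcon
  refine hθ.2 (isStable_of_separated hg (hsep V θ hV (not_lt.1 hcon)) (by positivity) ?_ ?_)
  · linarith [min_le_left (g / 2) (g * κ / (4 * Fintype.card G))]
  · have := min_le_right (g / 2) (g * κ / (4 * Fintype.card G))
    rw [le_div_iff₀ (by positivity)] at this
    linarith

/-- Some eigenvector of the Floquet matrix has a non-negligible mean, since the constant function is
a combination of them. -/
lemma exists_eigenvector_le_norm_sum (s : Fin d → G) (θ : Fin d → ℝ) (V : G → ℝ) :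
    ∃ (l : ℝ) (v : G → ℂ), (floquetMatrix s θ V).mulVec v = (l : ℂ) • v ∧ (∀ x, ‖v x‖ ≤ 1) ∧
      1 ≤ ‖∑ x, v x‖ := by
  set hA := isHermitian_floquetMatrix s θ V
  let one : EuclideanSpace ℂ G := WithLp.toLp 2 fun _ => 1
  have hsum : ∑ i, ‖inner ℂ one (hA.eigenvectorBasis i)‖ ^ 2 = ∑ _i : G, (1 : ℝ) := by
    rw [hA.eigenvectorBasis.sum_sq_norm_inner_left, EuclideanSpace.norm_eq, Real.sq_sqrt]
    · simp [one]
    · positivity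
  obtain ⟨i, -, hi⟩ := Finset.exists_le_of_sum_le Finset.univ_nonempty hsum.ge
  refine ⟨hA.eigenvalues i, hA.eigenvectorBasis i, ?_, fun x => ?_, ?_⟩
  · rw [hA.mulVec_eigenvectorBasis i]
    ext x
    simp
  · exact (PiLp.norm_apply_le _ x).trans_eq (hA.eigenvectorBasis.norm_eq_one i)
  · have : inner ℂ one (hA.eigenvectorBasis i) = ∑ x, hA.eigenvectorBasis i x := by
      simp [PiLp.inner_apply, one]
    rw [← this]
    exact (one_le_sq_iff₀ (norm_nonneg _)).1 hi

end Stability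

/-! ### Periodic functions on `ℤ^d` and functions on a finite torus -/

section Periodic

variable {d : ℕ} {α : Type*} {q : Fin d → ℕ}

lemma IsPeriodic.add_single_mul {V : (Fin d → ℤ) → α} (hV : IsPeriodic q V) (i : Fin d) (k : ℤ)
    (n : Fin d → ℤ) : V (n + Pi.single i (k * q i)) = V n := by
  induction k using Int.induction_on generalizing n with
  | zero => simp
  | succ k ih =>
    rw [add_mul, one_mul, Pi.single_add, ← add_assoc, hV, ih]
  | pred k ih =>
    rw [sub_mul, one_mul, ← hV i]
    rw [add_assoc, ← Pi.single_add, sub_add_cancel, ih]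

lemma IsPeriodic.eq_of_dvd {V : (Fin d → ℤ) → α} (hV : IsPeriodic q V) {n m : Fin d → ℤ}
    (h : ∀ i, (q i : ℤ) ∣ m i - n i) : V m = V n := by
  choose k hk using h
  have key : ∀ S : Finset (Fin d), V (n + ∑ i ∈ S, Pi.single i (k i * q i)) = V n := by
    intro S
    induction S using Finset.induction_on with
    | empty => simp
    | insert i S hi ih =>
      rw [Finset.sum_insert hi, add_comm (Pi.single i _), ← add_assoc, hV.add_single_mul, ih]
  rw [← key Finset.univ, Finset.univ_sum_single]
  congr 1
  ext i
  have := hk i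
  simp only [Pi.add_apply]
  linarith

lemma IsPeriodic.of_dvd {q' : Fin d → ℕ} (h : ∀ i, q i ∣ q' i) {V : (Fin d → ℤ) → α}
    (hV : IsPeriodic q V) : IsPeriodic q' V := by
  intro i n
  refine hV.eq_of_dvd fun j => ?_
  by_cases hj : j = i
  · subst hj
    simpa using Int.natCast_dvd_natCast.2 (h j)
  · simp [hj]

/-- The reduction `ℤ^d → ∏ i, ℤ / q i`. -/
def toTorus (q : Fin d → ℕ) (n : Fin d → ℤ) : ∀ i, ZMod (q i) := fun i => (n i : ZMod (q i))

lemma toTorus_add (n m : Fin d → ℤ) : toTorus q (n + m) = toTorus q n + toTorus q m := by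
  ext i
  simp [toTorus]

lemma toTorus_sub (n m : Fin d → ℤ) : toTorus q (n - m) = toTorus q n - toTorus q m := by
  ext i
  simp [toTorus]

lemma toTorus_surjective (q : Fin d → ℕ) : Function.Surjective (toTorus q) := by
  intro x
  exact ⟨fun i => (x i).cast, funext fun i => by simp [toTorus]⟩

/-- The `i`-th unit step on the torus. -/
def torusStep (q : Fin d → ℕ) (i : Fin d) : ∀ i, ZMod (q i) := toTorus q (Pi.single i 1)

lemma torusStep_generate (q : Fin d → ℕ) (x : ∀ i, ZMod (q i)) :
    ∃ n : Fin d → ℤ, x = ∑ i, n i • torusStep q i := by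
  obtain ⟨n, rfl⟩ := toTorus_surjective q x
  refine ⟨n, ?_⟩
  ext j
  rw [Finset.sum_apply, Finset.sum_eq_single j]
  · simp [toTorus, torusStep]
  · intro i _ hij
    simp [toTorus, torusStep, Ne.symm hij]
  · simp

lemma isPeriodic_comp_toTorus (f : (∀ i, ZMod (q i)) → α) :
    IsPeriodic q fun n => f (toTorus q n) := by
  intro i n
  refine congr_arg f (funext fun j => ?_)
  by_cases hj : j = i
  · subst hj
    simp [toTorus]
  · simp [toTorus, hj]

lemma IsPeriodic.exists_eq_comp {V : (Fin d → ℤ) → α} (hV : IsPeriodic q V) :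
    ∃ f : (∀ i, ZMod (q i)) → α, V = fun n => f (toTorus q n) := by
  refine ⟨fun x => V (Function.surjInv (toTorus_surjective q) x), ?_⟩
  ext n
  refine hV.eq_of_dvd fun i => ?_
  rw [← ZMod.intCast_eq_intCast_iff_dvd_sub]
  exact congr_fun (Function.surjInv_eq (toTorus_surjective q) (toTorus q n)) i

lemma IsIncreasingPeriods.dvd {p : ℕ → Fin d → ℕ} (hp : IsIncreasingPeriods p) {k j : ℕ}
    (h : k ≤ j) (i : Fin d) : p k i ∣ p j i :=
  Nat.le_induction (dvd_refl _) (fun n _ ih => ih.trans (hp.2 n i)) j h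

lemma IsPeriodic.sum_range {p : ℕ → Fin d → ℕ} (hp : IsIncreasingPeriods p) [AddCommMonoid α]
    {W : ℕ → (Fin d → ℤ) → α} (hW : ∀ j, IsPeriodic (p j) (W j)) (j : ℕ) :
    IsPeriodic (p j) fun n => ∑ k ∈ Finset.range (j + 1), W k n := by
  intro i n
  exact Finset.sum_congr rfl fun k hk =>
    (hW k).of_dvd (hp.dvd (Nat.lt_succ_iff.1 (Finset.mem_range.1 hk))) i n

end Periodic

/-! ### Bloch waves -/

section Bloch

variable {d : ℕ}

/-- The Schrödinger operator conjugated by the plane wave: its action on the factor `v` of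
`e(-n · θ) v(n)`. -/
def blochOperator (θ : Fin d → ℝ) (V : (Fin d → ℤ) → ℝ) (v : (Fin d → ℤ) → ℂ)
    (n : Fin d → ℤ) : ℂ :=
  ∑ i, (wave (-θ i) * v (n + Pi.single i 1) + wave (θ i) * v (n - Pi.single i 1)) +
    (V n : ℂ) * v n

lemma planeWave_eq (θ : Fin d → ℝ) (n : Fin d → ℤ) : planeWave θ n = wave (∑ i, n i * θ i) := rfl

lemma schrodinger_wave_mul (θ : Fin d → ℝ) (V : (Fin d → ℤ) → ℝ) (v : (Fin d → ℤ) → ℂ)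
    (n : Fin d → ℤ) : schrodinger V (fun n => wave (-∑ i, n i * θ i) * v n) n =
      wave (-∑ i, n i * θ i) * blochOperator θ V v n := by
  have hs : ∀ i, ∑ j, ((Pi.single i 1 : Fin d → ℤ) j : ℝ) * θ j = θ i := by
    intro i
    rw [Finset.sum_eq_single i]
    · simp
    · intro j _ hj
      simp [hj]
    · simp
  simp only [schrodinger, laplacian, blochOperator, Pi.add_apply, Pi.sub_apply, Int.cast_add,
    Int.cast_sub, add_mul, sub_mul, Finset.sum_add_distrib, Finset.sum_sub_distrib, hs, neg_add,
    neg_sub', sub_neg_eq_add, wave_add, mul_add, Finset.mul_sum]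
  congr 1
  · congr 1 <;> exact Finset.sum_congr rfl fun i _ => by ring
  · ring

lemma blochOperator_comp_toTorus (q : Fin d → ℕ) (θ : Fin d → ℝ) [∀ i, NeZero (q i)]
    (V : (∀ i, ZMod (q i)) → ℝ) (v : (∀ i, ZMod (q i)) → ℂ) (n : Fin d → ℤ) :
    blochOperator θ (fun n => V (toTorus q n)) (fun n => v (toTorus q n)) n =
      (floquetMatrix (torusStep q) θ V).mulVec v (toTorus q n) := by
  simp [blochOperator, floquetMatrix, hoppingMatrix_mulVec, toTorus_add, toTorus_sub, torusStep]

/-- The lift of `IsStable` to `q`-periodic functions on `ℤ^d`. -/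
def IsBlochStable (q : Fin d → ℕ) (V : (Fin d → ℤ) → ℝ) (ε κ : ℝ) (θ : Fin d → ℝ) : Prop :=
  ∀ (W : (Fin d → ℤ) → ℝ) (v : (Fin d → ℤ) → ℂ) (l : ℝ), IsPeriodic q W → IsPeriodic q v →
    (∀ n, |W n| ≤ ε) → (∀ n, ‖v n‖ ≤ 2) → (∀ n, blochOperator θ V v n = l * v n) →
    ∃ (m : ℝ) (w : (Fin d → ℤ) → ℂ), IsPeriodic q w ∧
      (∀ n, blochOperator θ (fun n => V n + W n) w n = m * w n) ∧ ∀ n, ‖w n - v n‖ ≤ κ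

lemma exists_forall_measure_not_isBlochStable_le {q : Fin d → ℕ} (hq : ∀ i, 0 < q i) (B r : ℝ)
    {κ : ℝ} (hκ : 0 < κ) {η : ENNReal} (hη : η ≠ 0) :
    ∃ ε : ℝ, 0 < ε ∧ ∀ V : (Fin d → ℤ) → ℝ, IsPeriodic q V → (∀ n, |V n| ≤ B) →
      volume {θ ∈ Metric.closedBall (0 : Fin d → ℝ) r | ¬ IsBlochStable q V ε κ θ} ≤ η := by
  have : ∀ i, NeZero (q i) := fun i => ⟨(hq i).ne'⟩
  have hsurj := toTorus_surjective q
  obtain ⟨ε, hε, h⟩ := exists_forall_measure_not_isStable_le (torusStep_generate q) B r hκ hη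
  refine ⟨ε, hε, fun V hV hVB => ?_⟩
  obtain ⟨V, rfl⟩ := hV.exists_eq_comp
  refine le_trans (measure_mono ?_) (h V (hsurj.forall.2 hVB))
  refine fun θ hθ => ⟨hθ.1, fun hstab => hθ.2 ?_⟩
  intro W v l hW hv hWε hv2 hvl
  obtain ⟨W, rfl⟩ := hW.exists_eq_comp
  obtain ⟨v, rfl⟩ := hv.exists_eq_comp
  obtain ⟨m, w, hw, hwv⟩ := hstab W v l (hsurj.forall.2 hWε) (hsurj.forall.2 hv2)
    (funext (hsurj.forall.2 fun n => by
      rw [← blochOperator_comp_toTorus, hvl]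
      rfl))
  refine ⟨m, fun n => w (toTorus q n), isPeriodic_comp_toTorus w, fun n => ?_,
    fun n => hwv (toTorus q n)⟩
  rw [blochOperator_comp_toTorus q θ (fun x => V x + W x) w n, hw]
  rfl

end Bloch

/-! ### Averages over boxes -/

section Averages

variable {d : ℕ}

/-- The average of `v` over the box of radius `R`. -/
def boxMean (v : (Fin d → ℤ) → ℂ) (R : ℕ) : ℂ := ((box d R).card : ℂ)⁻¹ * ∑ n ∈ box d R, v n

lemma card_box (d R : ℕ) : (box d R).card = (2 * R + 1) ^ d := by
  simp only [box, Fintype.card_piFinset, Int.card_Icc, Finset.prod_const, Finset.card_univ,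
    Fintype.card_fin]
  congr 1
  omega

lemma norm_boxMean_sub_le {v w : (Fin d → ℤ) → ℂ} {c : ℝ} (h : ∀ n, ‖v n - w n‖ ≤ c) (R : ℕ) :
    ‖boxMean v R - boxMean w R‖ ≤ c := by
  have hpos : (0 : ℝ) < (box d R).card := by
    rw [card_box]
    positivity
  rw [boxMean, boxMean, ← mul_sub, ← Finset.sum_sub_distrib, norm_mul, norm_inv,
    Complex.norm_natCast, inv_mul_le_iff₀ hpos]
  exact (norm_sum_le_of_le _ fun n _ => h n).trans_eq (by simp)

lemma tendsto_card_filter_intCast_eq {q : ℕ} (hq : 0 < q) (x : ZMod q) :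
    Tendsto (fun R : ℕ => ((((Finset.Icc (-(R : ℤ)) R).filter fun m : ℤ => (m : ZMod q) = x).card :
      ℕ) : ℝ) / (2 * R + 1)) atTop (𝓝 (q : ℝ)⁻¹) := by
  have hqR : (0 : ℝ) < q := by exact_mod_cast hq
  have hlim : Tendsto (fun R : ℕ => 1 / (2 * (R : ℝ) + 1)) atTop (𝓝 0) := by
    refine tendsto_const_nhds.div_atTop (tendsto_atTop_add_const_right _ _ ?_)
    exact tendsto_natCast_atTop_atTop.const_mul_atTop two_pos
  refine tendsto_iff_norm_sub_tendsto_zero.2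
    (squeeze_zero (fun _ => norm_nonneg _) (fun R => ?_) hlim)
  obtain ⟨a, rfl⟩ := ZMod.intCast_surjective x
  have hcard : ((((Finset.Icc (-(R : ℤ)) R).filter fun m : ℤ =>
      (m : ZMod q) = (a : ZMod q)).card : ℕ) : ℤ) =
      max (⌊((R : ℤ) - a) / ((q : ℤ) : ℚ)⌋ - ⌊(((-R - 1 : ℤ) : ℚ) - a) / ((q : ℤ) : ℚ)⌋) 0 := by
    rw [← Int.Ioc_filter_modEq_card (-R - 1 : ℤ) (R : ℤ) (by exact_mod_cast hq)]
    congr 2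
    ext m
    simp only [Finset.mem_filter, Finset.mem_Icc, Finset.mem_Ioc, ZMod.intCast_eq_intCast_iff]
    exact and_congr_left fun _ => by omega
  set N := ((Finset.Icc (-(R : ℤ)) R).filter fun m : ℤ => (m : ZMod q) = (a : ZMod q)).card
  have hbound : |(N : ℚ) - (2 * R + 1) / q| ≤ 1 := by
    have hqQ : (0 : ℚ) < q := by exact_mod_cast hq
    have h1 : (N : ℚ) = ((N : ℤ) : ℚ) := by simp
    rw [h1, hcard]
    push_cast
    set x : ℚ := ((R : ℚ) - a) / q
    set y : ℚ := (-(R : ℚ) - 1 - a) / q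
    have hxy : x - y = (2 * R + 1) / q := by
      simp only [x, y]
      ring
    have hle : y ≤ x := by
      have : (0 : ℚ) ≤ (2 * R + 1) / q := by positivity
      linarith
    have hfl : ((⌊y⌋ : ℤ) : ℚ) ≤ ⌊x⌋ := by exact_mod_cast Int.floor_mono hle
    rw [max_eq_left (by linarith), ← hxy, abs_le]
    constructor <;> linarith [Int.floor_le x, Int.floor_le y, Int.lt_floor_add_one x,
      Int.lt_floor_add_one y]
  have hbound' : |(N : ℝ) - (2 * R + 1) / q| ≤ 1 := by
    have := (Rat.cast_le (K := ℝ)).2 hbound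
    push_cast at this
    exact this
  have hR : (0 : ℝ) < 2 * R + 1 := by positivity
  rw [Real.norm_eq_abs, show (N : ℝ) / (2 * R + 1) - (q : ℝ)⁻¹ =
    ((N : ℝ) - (2 * R + 1) / q) / (2 * R + 1) by field_simp, abs_div, abs_of_pos hR]
  exact div_le_div_of_nonneg_right hbound' hR.le

lemma tendsto_boxMean_comp_toTorus {q : Fin d → ℕ} [∀ i, NeZero (q i)]
    (f : (∀ i, ZMod (q i)) → ℂ) :
    Tendsto (boxMean fun n => f (toTorus q n)) atTop (𝓝 (∑ x, f x * ∏ i, ((q i : ℝ)⁻¹ : ℝ))) := by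
  have hmean : (boxMean fun n => f (toTorus q n)) = fun R : ℕ => ∑ x, f x *
      ((∏ i, (((((Finset.Icc (-(R : ℤ)) R).filter fun m : ℤ => (m : ZMod (q i)) = x i).card : ℕ) :
        ℝ) / (2 * R + 1)) : ℝ) : ℂ) := by
    ext R
    have hfib : ∀ x : ∀ i, ZMod (q i), (box d R).filter (fun n => toTorus q n = x) =
        Fintype.piFinset fun i =>
          (Finset.Icc (-(R : ℤ)) R).filter fun m : ℤ => (m : ZMod (q i)) = x i := by
      intro x
      ext n
      simp only [box, Finset.mem_filter, Fintype.mem_piFinset, toTorus, funext_iff, forall_and]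
    rw [boxMean, ← Finset.sum_fiberwise (box d R) (toTorus q), Finset.mul_sum]
    refine Finset.sum_congr rfl fun x _ => ?_
    rw [Finset.sum_congr rfl fun n hn => by rw [(Finset.mem_filter.1 hn).2], Finset.sum_const,
      hfib, Fintype.card_piFinset, card_box, Finset.prod_div_distrib]
    simp
    ring
  rw [hmean]
  refine tendsto_finsetSum _ fun x _ => Tendsto.const_mul _ ?_
  have := tendsto_finsetProd Finset.univ fun i (_ : i ∈ Finset.univ) =>
    tendsto_card_filter_intCast_eq (Nat.pos_of_neZero (q i)) (x i)
  have h2 := (Complex.continuous_ofReal.tendsto _).comp this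
  simpa [Function.comp_def] using h2

lemma IsPeriodic.exists_tendsto_boxMean {q : Fin d → ℕ} (hq : ∀ i, 0 < q i)
    {v : (Fin d → ℤ) → ℂ} (hv : IsPeriodic q v) : ∃ c, Tendsto (boxMean v) atTop (𝓝 c) := by
  have : ∀ i, NeZero (q i) := fun i => ⟨(hq i).ne'⟩
  obtain ⟨f, rfl⟩ := hv.exists_eq_comp
  exact ⟨_, tendsto_boxMean_comp_toTorus f⟩

/-- Uniform limits of functions possessing a mean possess a mean. -/
lemma exists_tendsto_boxMean_of_tendstoUniformly {v : ℕ → (Fin d → ℤ) → ℂ} {w : (Fin d → ℤ) → ℂ}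
    (hv : ∀ k, ∃ c, Tendsto (boxMean (v k)) atTop (𝓝 c)) (h : TendstoUniformly v w atTop) :
    ∃ c, Tendsto (boxMean w) atTop (𝓝 c) := by
  refine cauchySeq_tendsto_of_complete (Metric.cauchySeq_iff'.2 fun ε hε => ?_)
  obtain ⟨k, hk⟩ := (Metric.tendstoUniformly_iff.1 h (ε / 4) (by positivity)).exists
  obtain ⟨c, hc⟩ := hv k
  obtain ⟨N, hN⟩ := Metric.cauchySeq_iff'.1 hc.cauchySeq (ε / 4) (by positivity)
  refine ⟨N, fun n hn => ?_⟩
  have hd : ∀ R, dist (boxMean w R) (boxMean (v k) R) ≤ ε / 4 := fun R => by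
    rw [dist_eq_norm]
    exact norm_boxMean_sub_le (fun n => by simpa [dist_eq_norm] using (hk n).le) R
  have h1 := dist_triangle4 (boxMean w n) (boxMean (v k) n) (boxMean (v k) N) (boxMean w N)
  have h2 := hd n
  have h3 := hd N
  rw [dist_comm] at h3
  have h4 := hN n hn
  linarith

/-- At every quasi-momentum some periodic Bloch wave has a mean of size at least `1 / ∏ i, q i`. -/
lemma exists_bloch_wave_le_norm_mean {q : Fin d → ℕ} (hq : ∀ i, 0 < q i)
    {V : (Fin d → ℤ) → ℝ} (hV : IsPeriodic q V) (θ : Fin d → ℝ) :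
    ∃ (l : ℝ) (v : (Fin d → ℤ) → ℂ) (c : ℂ), IsPeriodic q v ∧ (∀ n, ‖v n‖ ≤ 1) ∧
      (∀ n, blochOperator θ V v n = l * v n) ∧ Tendsto (boxMean v) atTop (𝓝 c) ∧
      (∏ i, (q i : ℝ))⁻¹ ≤ ‖c‖ := by
  have : ∀ i, NeZero (q i) := fun i => ⟨(hq i).ne'⟩
  obtain ⟨V, rfl⟩ := hV.exists_eq_comp
  obtain ⟨l, v, hvl, hv1, hsum⟩ := exists_eigenvector_le_norm_sum (torusStep q) θ V
  refine ⟨l, fun n => v (toTorus q n), _, isPeriodic_comp_toTorus v, fun n => hv1 _, fun n => ?_,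
    tendsto_boxMean_comp_toTorus v, ?_⟩
  · rw [blochOperator_comp_toTorus, hvl]
    rfl
  · rw [← Finset.sum_mul, norm_mul, Complex.norm_real, Real.norm_eq_abs,
      abs_of_nonneg (by positivity), Finset.prod_inv_distrib]
    exact le_mul_of_one_le_left (by positivity) hsum

end Averages

/-! ### Passage to the limit -/

section Limit

variable {d : ℕ}

lemma isLimitPeriodic_of_tendstoUniformly {α : Type*} [NormedAddCommGroup α] {p : ℕ → Fin d → ℕ}
    (hp : IsIncreasingPeriods p) {v : ℕ → (Fin d → ℤ) → α} {w : (Fin d → ℤ) → α}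
    (hv : ∀ k, IsPeriodic (p k) (v k)) (h : TendstoUniformly v w atTop) : IsLimitPeriodic w := by
  let D : ℕ → (Fin d → ℤ) → α := fun k n => Nat.casesOn k (v 0 n) fun k => v (k + 1) n - v k n
  refine ⟨p, D, hp, fun k => ?_, ?_⟩
  · cases k with
    | zero => exact hv 0
    | succ k =>
      intro i n
      exact congr_arg₂ (· - ·) (hv (k + 1) i n) ((hv k).of_dvd (hp.2 k) i n)
  · have hD : ∀ j n, ∑ k ∈ Finset.range (j + 1), D k n = v j n := by
      intro j n
      rw [Finset.sum_range_succ', Finset.sum_range_sub (fun k => v k n)]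
      exact sub_add_cancel _ _
    simpa only [SumsTo, hD] using h

/-- A geometrically convergent sequence of periodic Bloch waves whose first term has a mean larger
than the total displacement converges to a limit-periodic Bloch wave with non-zero mean. -/
theorem exists_limitPeriodic_eigenfunction {p : ℕ → Fin d → ℕ} (hp : IsIncreasingPeriods p)
    (θ : Fin d → ℝ) {U : ℕ → (Fin d → ℤ) → ℝ} {V : (Fin d → ℤ) → ℝ}
    (hU : ∀ n, Tendsto (fun k => U k n) atTop (𝓝 (V n))) {l : ℕ → ℝ} {v : ℕ → (Fin d → ℤ) → ℂ}
    (hv : ∀ k, IsPeriodic (p k) (v k)) (hvl : ∀ k n, blochOperator θ (U k) (v k) n = l k * v k n)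
    {C : ℝ} (hC : ∀ k n, dist (v k n) (v (k + 1) n) ≤ C / 2 / 2 ^ k) {c₀ : ℂ}
    (hc₀ : Tendsto (boxMean (v 0)) atTop (𝓝 c₀)) (hCc : C < ‖c₀‖) :
    ∃ (E : ℝ) (u : (Fin d → ℤ) → ℂ), u ≠ 0 ∧ IsBlochLimitPeriodic θ u ∧
      (∀ n, schrodinger V u n = (E : ℂ) * u n) ∧
      ∃ c : ℂ, c ≠ 0 ∧ Tendsto (boxAverage u θ) atTop (𝓝 c) := by
  choose w hw using fun n => cauchySeq_tendsto_of_complete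
    (cauchySeq_of_le_geometric_two (f := fun k => v k n) (fun k => hC k n))
  have hdist : ∀ k n, dist (v k n) (w n) ≤ C / 2 ^ k := fun k n =>
    dist_le_of_le_geometric_two_of_tendsto (fun k => hC k n) (hw n) k
  have hunif : TendstoUniformly v w atTop := by
    refine Metric.tendstoUniformly_iff.2 fun ε hε => ?_
    have hlim : Tendsto (fun k : ℕ => C / 2 ^ k) atTop (𝓝 0) :=
      tendsto_const_nhds.div_atTop (tendsto_pow_atTop_atTop_of_one_lt one_lt_two)
    filter_upwards [hlim.eventually (gt_mem_nhds hε)] with k hk n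
    rw [dist_comm]
    exact (hdist k n).trans_lt hk
  obtain ⟨c, hc⟩ := exists_tendsto_boxMean_of_tendstoUniformly
    (fun k => (hv k).exists_tendsto_boxMean (hp.1 k)) hunif
  have hc0 : c ≠ 0 := by
    rintro rfl
    have h1 : ‖c₀ - 0‖ ≤ C := le_of_tendsto (hc₀.sub hc).norm
      (Eventually.of_forall fun R => norm_boxMean_sub_le
        (fun n => by simpa [dist_eq_norm] using hdist 0 n) R)
    rw [sub_zero] at h1
    linarith
  obtain ⟨n₀, hn₀⟩ : ∃ n, w n ≠ 0 := by
    by_contra! h0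
    refine hc0 (tendsto_nhds_unique hc ?_)
    have : boxMean w = fun _ => 0 := by
      ext R
      simp [boxMean, h0]
    rw [this]
    exact tendsto_const_nhds
  have hop : ∀ n, Tendsto (fun k => blochOperator θ (U k) (v k) n) atTop
      (𝓝 (blochOperator θ V w n)) := by
    intro n
    refine Tendsto.add (tendsto_finsetSum _ fun i _ => ?_) ?_
    · exact ((hw _).const_mul _).add ((hw _).const_mul _)
    · exact ((Complex.continuous_ofReal.tendsto _).comp (hU n)).mul (hw n)
  -- The eigenvalues converge since the eigenfunctions do, at a site where the limit is non-zero.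
  have hl : Tendsto (fun k => (l k : ℂ)) atTop (𝓝 (blochOperator θ V w n₀ / w n₀)) := by
    refine ((hop n₀).div (hw n₀) hn₀).congr' ?_
    filter_upwards [(hw n₀).eventually_ne hn₀] with k hk
    simp only [Pi.div_apply, hvl]
    exact mul_div_cancel_right₀ _ hk
  obtain ⟨E, hE⟩ : ∃ E : ℝ, (E : ℂ) = blochOperator θ V w n₀ / w n₀ :=
    Complex.isometry_ofReal.isClosedEmbedding.isClosed_range.mem_of_tendsto hl
      (Eventually.of_forall fun k => ⟨l k, rfl⟩)
  rw [← hE] at hl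
  have hwE : ∀ n, blochOperator θ V w n = E * w n := fun n =>
    tendsto_nhds_unique (hop n) (by simpa only [hvl] using hl.mul (hw n))
  refine ⟨E, fun n => wave (-∑ i, n i * θ i) * w n, fun h0 => ?_, ?_, fun n => ?_, c, hc0, ?_⟩
  · exact (mul_ne_zero (wave_ne_zero _) hn₀) (congr_fun h0 n₀)
  · refine isLimitPeriodic_of_tendstoUniformly hp hv ?_
    convert hunif using 2 with n
    rw [planeWave_eq, ← mul_assoc, wave_mul_wave_neg, one_mul]
  · rw [schrodinger_wave_mul, hwE]
    ring
  · convert hc using 1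
    ext R
    refine congr_arg (_ * ·) (Finset.sum_congr rfl fun n _ => ?_)
    rw [planeWave_eq, mul_right_comm, mul_comm (wave _) (wave _), wave_mul_wave_neg, one_mul]

/-- Starting from a Bloch wave at level `0` that has a large mean, stability at every level allows
the construction of the sequence of Bloch waves. -/
theorem exists_limitPeriodic_eigenfunction_of_stable {p : ℕ → Fin d → ℕ}
    (hp : IsIncreasingPeriods p) (θ : Fin d → ℝ) {W U : ℕ → (Fin d → ℤ) → ℝ}
    {V : (Fin d → ℤ) → ℝ} (hU : ∀ n, Tendsto (fun k => U k n) atTop (𝓝 (V n)))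
    (hU0 : IsPeriodic (p 0) (U 0)) (hW : ∀ k, IsPeriodic (p k) (W k))
    (hUW : ∀ k, U (k + 1) = fun n => U k n + W (k + 1) n) {ε κ : ℕ → ℝ}
    (hWε : ∀ k n, |W (k + 1) n| ≤ ε k)
    (hκ : ∀ k, κ k ≤ (∏ i, (p 0 i : ℝ))⁻¹ / 2 / 2 / 2 ^ k)
    (hstab : ∀ k, IsBlochStable (p (k + 1)) (U k) (ε k) (κ k) θ) :
    ∃ (E : ℝ) (u : (Fin d → ℤ) → ℂ), u ≠ 0 ∧ IsBlochLimitPeriodic θ u ∧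
      (∀ n, schrodinger V u n = (E : ℂ) * u n) ∧
      ∃ c : ℂ, c ≠ 0 ∧ Tendsto (boxAverage u θ) atTop (𝓝 c) := by
  have hone : (∏ i, (p 0 i : ℝ))⁻¹ ≤ 1 := by
    refine inv_le_one_of_one_le₀ ?_
    exact_mod_cast Nat.succ_le_of_lt (Finset.prod_pos fun i _ => hp.1 0 i)
  have hpos : 0 < (∏ i, (p 0 i : ℝ))⁻¹ :=
    inv_pos.2 (Finset.prod_pos fun i _ => by exact_mod_cast hp.1 0 i)
  obtain ⟨l₀, v₀, c₀, hv₀p, hv₀, hvl₀, hc₀, hle⟩ :=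
    exists_bloch_wave_le_norm_mean (hp.1 0) hU0 θ
  let P : ℕ → ℝ × ((Fin d → ℤ) → ℂ) → Prop := fun k z => IsPeriodic (p k) z.2 ∧
    (∀ n, ‖z.2 n‖ ≤ 2 - 1 / 2 ^ k) ∧ ∀ n, blochOperator θ (U k) z.2 n = z.1 * z.2 n
  have step : ∀ k z, P k z → ∃ z', P (k + 1) z' ∧ ∀ n, ‖z'.2 n - z.2 n‖ ≤ κ k := by
    rintro k ⟨l, v⟩ ⟨hvp, hv2, hvl⟩
    obtain ⟨m, w, hwp, hwm, hwv⟩ := hstab k (W (k + 1)) v l (hW _) (hvp.of_dvd (hp.2 k)) (hWε k)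
      (fun n => (hv2 n).trans (sub_le_self _ (by positivity))) hvl
    refine ⟨(m, w), ⟨hwp, fun n => ?_, fun n => ?_⟩, hwv⟩
    · have h1 : ‖w n‖ ≤ κ k + (2 - 1 / 2 ^ k) := by
        have := norm_add_le_of_le (hwv n) (hv2 n)
        rwa [sub_add_cancel] at this
      have h2 : κ k ≤ 1 / 2 / 2 ^ k := by
        refine (hκ k).trans (div_le_div_of_nonneg_right ?_ (by positivity))
        linarith
      have h3 : (1 : ℝ) / 2 / 2 ^ k = 1 / 2 ^ k - 1 / 2 ^ (k + 1) := by
        rw [pow_succ]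
        field_simp
        norm_num
      change ‖w n‖ ≤ _
      linarith
    · rw [hUW]
      exact hwm n
  let z : ∀ k, {z // P k z} := fun k => Nat.rec
    ⟨(l₀, v₀), hv₀p, fun n => (hv₀ n).trans (by norm_num), hvl₀⟩
    (fun k z => ⟨(step k z.1 z.2).choose, (step k z.1 z.2).choose_spec.1⟩) k
  have hz : ∀ k n, ‖(z (k + 1)).1.2 n - (z k).1.2 n‖ ≤ κ k := fun k =>
    (step k (z k).1 (z k).2).choose_spec.2
  refine exists_limitPeriodic_eigenfunction hp θ hU (fun k => (z k).2.1) (fun k => (z k).2.2.2)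
    (C := (∏ i, (p 0 i : ℝ))⁻¹ / 2) (fun k n => ?_) hc₀ ?_
  · rw [dist_comm, dist_eq_norm]
    exact (hz k n).trans (hκ k)
  · linarith

end Limit

end LimitPeriodicSchrodinger

end

theorem theorem2 (d : ℕ) (hd : 1 ≤ d) (ε₁ : ℝ) (hε₁ : 0 < ε₁) (p : ℕ → Fin d → ℕ)
    (hp : LimitPeriodicSchrodinger.IsIncreasingPeriods p) :
    ∃ ε : ℕ → ℝ, ε 0 = ε₁ ∧ (∀ j, 0 < ε j) ∧
      ∀ W : ℕ → (Fin d → ℤ) → ℝ,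
        (∀ j, LimitPeriodicSchrodinger.IsPeriodic (p j) (W j)) →
        (∀ j n, |W j n| ≤ ε j) →
        ∃ V : (Fin d → ℤ) → ℝ,
          LimitPeriodicSchrodinger.SumsTo W V ∧
          ∀ᵐ θ : Fin d → ℝ,
            ∃ (E : ℝ) (u : (Fin d → ℤ) → ℂ),
              u ≠ 0 ∧
              LimitPeriodicSchrodinger.IsBlochLimitPeriodic θ u ∧
              (∀ n, LimitPeriodicSchrodinger.schrodinger V u n = (E : ℂ) * u n) ∧
              ∃ c : ℂ, c ≠ 0 ∧
                Tendsto (LimitPeriodicSchrodinger.boxAverage u θ) atTop (𝓝 c) := by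
  have hprod : ∀ j, 0 < ∏ i, (p j i : ℝ) := fun j =>
    Finset.prod_pos fun i _ => by exact_mod_cast hp.1 j i
  -- With this choice the displacements of the levels `j ≥ J` add up to at most half of the lower
  -- bound `(∏ i, p J i)⁻¹` for the mean at level `J`.
  let κ : ℕ → ℝ := fun j => (∏ i, (p j i : ℝ))⁻¹ / 2 / 2 / 2 ^ j
  have hκ : ∀ j, 0 < κ j := fun j => by
    have := hprod j
    positivity
  have hη : ∀ j : ℕ, (2⁻¹ : ENNReal) ^ j ≠ 0 := fun j => pow_ne_zero j (by simp)
  -- All terms after the first will be at most `1`, so `ε₁ + j` bounds the partial sum `U j` and the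
  -- choice at one level does not refer to the previous choices.
  choose e he hgood using fun j : ℕ =>
    LimitPeriodicSchrodinger.exists_forall_measure_not_isBlochStable_le (hp.1 (j + 1)) (ε₁ + j) j
      (hκ j) (hη j)
  let ε : ℕ → ℝ := fun j => Nat.casesOn j ε₁ fun j => min (e j) ((1 / 2) ^ j)
  refine ⟨ε, rfl, fun j => ?_, fun W hW hWε => ?_⟩
  · cases j with
    | zero => exact hε₁
    | succ j => exact lt_min (he j) (by positivity)
  have hsum : Summable ε :=
    (summable_nat_add_iff 1).1 (Summable.of_nonneg_of_le
      (fun j => (lt_min (he j) (by positivity)).le) (fun j => min_le_right _ _)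
      summable_geometric_two)
  set U : ℕ → (Fin d → ℤ) → ℝ := fun j n => ∑ k ∈ Finset.range (j + 1), W k n
  have hUV : LimitPeriodicSchrodinger.SumsTo W fun n => ∑' k, W k n := fun s hs =>
    (tendsto_add_atTop_nat 1).eventually (tendstoUniformly_tsum_nat hsum hWε s hs)
  have hUB : ∀ j n, |U j n| ≤ ε₁ + j := by
    intro j n
    refine (Finset.abs_sum_le_sum_abs _ _).trans ((Finset.sum_le_sum fun k _ => hWε k n).trans ?_)
    rw [Finset.sum_range_succ', add_comm]
    refine add_le_add le_rfl ?_
    refine (Finset.sum_le_card_nsmul _ _ 1 fun k _ => ?_).trans (by simp)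
    exact (min_le_right _ _).trans (pow_le_one₀ (by norm_num) (by norm_num))
  have hUp : ∀ j, LimitPeriodicSchrodinger.IsPeriodic (p j) (U j) :=
    LimitPeriodicSchrodinger.IsPeriodic.sum_range hp hW
  refine ⟨_, hUV, ?_⟩
  have hBC := ae_eventually_notMem (μ := (volume : Measure (Fin d → ℝ)))
    (s := fun j => {θ ∈ Metric.closedBall (0 : Fin d → ℝ) j |
      ¬ LimitPeriodicSchrodinger.IsBlochStable (p (j + 1)) (U j) (e j) (κ j) θ}) (by
    refine ne_top_of_le_ne_top ?_ (ENNReal.tsum_le_tsum fun j =>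
      hgood j (U j) ((hUp j).of_dvd (hp.2 j)) (hUB j))
    rw [ENNReal.tsum_geometric]
    simp)
  filter_upwards [hBC] with θ hθ
  have hball : ∀ᶠ j : ℕ in atTop, θ ∈ Metric.closedBall (0 : Fin d → ℝ) j := by
    filter_upwards [tendsto_natCast_atTop_atTop.eventually_ge_atTop ‖θ‖] with j hj
    simpa using hj
  obtain ⟨J, hJ⟩ := eventually_atTop.1 (hθ.and hball)
  have hstab : ∀ k, LimitPeriodicSchrodinger.IsBlochStable (p (J + k + 1)) (U (J + k)) (e (J + k))
      (κ (J + k)) θ := fun k => by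
    have h := hJ (J + k) (Nat.le_add_right J k)
    by_contra hcon
    exact h.1 ⟨h.2, hcon⟩
  refine LimitPeriodicSchrodinger.exists_limitPeriodic_eigenfunction_of_stable
    (p := fun k => p (J + k)) (W := fun k => W (J + k)) (U := fun k => U (J + k))
    (ε := fun k => e (J + k)) (κ := fun k => κ (J + k))
    ⟨fun k => hp.1 _, fun k => hp.2 _⟩ θ (fun n => ?_) (hUp J) (fun k => hW _)
    (fun k => funext fun n => Finset.sum_range_succ _ _)
    (fun k n => (hWε (J + k + 1) n).trans (min_le_left _ _)) (fun k => ?_) hstab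
  · have h := (hUV.tendsto_at n).comp (tendsto_add_atTop_nat J)
    simpa only [Function.comp_def, add_comm _ J] using h
  · have h1 : (∏ i, (p (J + k) i : ℝ))⁻¹ ≤ (∏ i, (p J i : ℝ))⁻¹ := by
      refine inv_anti₀ (hprod J) (Finset.prod_le_prod (fun i _ => by positivity) fun i _ => ?_)
      exact_mod_cast Nat.le_of_dvd (hp.1 _ i) (hp.dvd (Nat.le_add_right J k) i)
    have h2 : (2 : ℝ) ^ k ≤ 2 ^ (J + k) := pow_le_pow_right₀ one_le_two (Nat.le_add_left k J)
    change (∏ i, (p (J + k) i : ℝ))⁻¹ / 2 / 2 / 2 ^ (J + k) ≤ _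
    have := hprod J
    simp only [add_zero]
    gcongr
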